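/- Let $\Sigma$ be a monoid (with no finiteness condition). A real representation of $\Sigma$ is a finite-dimensional real vector space $X$ with a monoid homomorphism $\sigma\mapsto A_\sigma$ from $\Sigma$ to the linear endomorphisms of $X$ (with $A_1=\mathrm{id}$). $\operatorname{End}_\Sigma(X)$ is the finite-dimensional real algebra of linear maps $L\colon X\to X$ with $LA_\sigma=A_\sigma L$ for all $\sigma\in\Sigma$, and $\operatorname{End}^{\mathrm{nil}}_\Sigma(X)$ is the set of its nilpotent elements. $X$ is indecomposable if $X\neq 0$ and $X$ is not the direct sum of two proper subrepresentations; then $\operatorname{End}^{\mathrm{nil}}_\Sigma(X)$ is an ideal of $\operatorname{End}_\Sigma(X)$, and the index of $X$ is $\operatorname{ind}X=\dim_{\mathbb R}\operatorname{End}_\Sigma(X)/\operatorname{End}^{\mathrm{nil}}_\Sigma(X)$. **Theorem.** Let $X$ be an indecomposable real representation of $\Sigma$ and let $V=X^s$ be the direct sum of $s\ge 1$ copies of $X$. Then $\operatorname{ind}X\in\{1,2,4\}$, and there are smooth embedded submanifolds $S_1,\dots,S_s$ of $\operatorname{End}_\Sigma(V)$ with $$\operatorname{End}^{\mathrm{nil}}_\Sigma(V)\subseteq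 S_1\cup\dots\cup S_s$$ of the following codimensions: (i) if $\operatorname{ind}X=1$, then $\operatorname{codim}S_1=s$ and $\operatorname{codim}S_i=i^2$ for $i=2,\dots,s$; (ii) if $\operatorname{ind}X=2$ or $4$, then $\operatorname{codim}S_i=i^2\operatorname{ind}X$ for $i=1,\dots,s$. (The empty set counts as a submanifold of every codimension; submanifolds need not be closed.) -/

import Mathlib

open scoped ContDiff DirectSum

namespace MonoidRep

section Representations

variable {G X : Type*} [Monoid G] [AddCommGroup X] [Module ℝ X]

/-- A real representation is indecomposable if it is nonzero and is not the internal direct sum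
of two proper subrepresentations (`IsCompl` is taken in the lattice of subrepresentations, so it
says that `W ⊓ W' = 0` and `W + W' = X`). -/
def IsIndecomposable (ρ : Representation ℝ G X) : Prop :=
  Nontrivial X ∧ ∀ W W' : Subrepresentation ρ, IsCompl W W' → W = ⊤ ∨ W' = ⊤

/-- The real algebra `End(X)` of endomorphisms of a representation: the linear maps that commute
with the action. Multiplication is composition. -/
abbrev EndRep (ρ : Representation ℝ G X) : Type _ := ρ.IntertwiningMap ρ

/-- The set of nilpotent endomorphisms of a representation. -/
def nilEnd (ρ : Representation ℝ G X) : Set (EndRep ρ) := {L | IsNilpotent L}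

/-- The index of a representation: the real dimension of the quotient of `End(X)` by the nilpotent
endomorphisms. For an indecomposable `X` of finite dimension, the nilpotent endomorphisms form an
ideal, so that the linear span below adds nothing to the set and the quotient is the division
algebra attached to `X`. -/
noncomputable def index (ρ : Representation ℝ G X) : ℕ :=
  Module.finrank ℝ (EndRep ρ ⧸ Submodule.span ℝ (nilEnd ρ))

/-- The representation `X ^ s`, the direct sum of `s` copies of `X`. -/
noncomputable abbrev power (ρ : Representation ℝ G X) (s : ℕ) :
    Representation ℝ G (⨁ _ : Fin s, X) :=
  Representation.directSum (fun _ : Fin s => ρ)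

end Representations

section Submanifolds

/-- Embedded smooth submanifolds of codimension `d` of a normed space: locally, `S` is the zero
set of a smooth map to `ℝ ^ d` of which `0` is a regular value. As usual, the empty set counts
as a submanifold of every codimension. -/
def IsNormedSubmanifold {F : Type*} [NormedAddCommGroup F] [NormedSpace ℝ F]
    (S : Set F) (d : ℕ) : Prop :=
  ∀ x ∈ S, ∃ U : Set F, IsOpen U ∧ x ∈ U ∧ ∃ f : F → (Fin d → ℝ),
    ContDiffOn ℝ ∞ f U ∧ (∀ y ∈ S ∩ U, Function.Surjective (fderiv ℝ f y)) ∧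
      S ∩ U = {y ∈ U | f y = 0}

/-- Embedded smooth submanifolds of codimension `d` of a real vector space `E` of finite dimension
that comes without a norm, such as `End(V)`: the space is identified with `ℝ ^ n` by linear
coordinates. All choices of linear coordinates give the same notion, as the changes of coordinates
are linear diffeomorphisms of `ℝ ^ n`. -/
def IsSubmanifold {E : Type*} [AddCommGroup E] [Module ℝ E] (S : Set E) (d : ℕ) : Prop :=
  ∃ e : E ≃ₗ[ℝ] (Fin (Module.finrank ℝ E) → ℝ), IsNormedSubmanifold (e '' S) d

end Submanifolds

end MonoidRep

/-!
Let `A` be the endomorphism algebra of the indecomposable representation `X`. By Fitting's lemma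
(`IsIndecomposable.isUnit_or_isNilpotent`) every element of `A` is a unit or nilpotent, so the
nilpotent elements form an ideal, with quotient a real division algebra `D` of dimension `ind X`
(`exists_algHom_divisionRing`, `index_eq_finrank`). By Frobenius' theorem this dimension is `1`, `2`
or `4` (`finrank_divisionRing_eq_one_or_two_or_four`).

The endomorphisms of `X ^ s` are the `s × s` matrices over `A` (`endMatrix`). Reducing their entries
gives a surjective algebra homomorphism to the `s × s` matrices over `D`, which preserves
nilpotency. As preimages of submanifolds under surjective linear maps are submanifolds of the same
codimension (`IsSubmanifold.preimage`), it suffices to cover the nilpotent matrices over `D`. Such a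
matrix is not invertible, and the matrices of corank `i` form a submanifold of codimension
`i ^ 2 * dim D`, with the Schur complement as a local equation (`isSubmanifold_finrank_ker`).

If `D = ℝ`, the codimension `1` of the stratum of corank one is improved to `s`. A nilpotent matrix
of corank one satisfies the `s` equations `tr (A ^ k) = 0` for `1 ≤ k ≤ s`, whose differentials are
independent at `A` because `1, A, …, A ^ (s - 1)` are
(`isSubmanifold_linearIndependent_pow_trace`, `linearIndependent_pow_of_corank_le_one`).
-/

namespace MonoidRep

open Module

/-! ### Preimages of submanifolds -/

theorem IsNormedSubmanifold.preimage {F F' : Type*} [NormedAddCommGroup F] [NormedSpace ℝ F]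
    [NormedAddCommGroup F'] [NormedSpace ℝ F'] {S : Set F'} {d : ℕ}
    (hS : IsNormedSubmanifold S d) (Φ : F →L[ℝ] F') (hΦ : Function.Surjective Φ) :
    IsNormedSubmanifold (Φ ⁻¹' S) d := by
  intro x hx
  obtain ⟨U, hU, hxU, f, hf, hsurj, heq⟩ := hS (Φ x) hx
  refine ⟨Φ ⁻¹' U, hU.preimage Φ.continuous, hxU, f ∘ Φ,
    hf.comp Φ.contDiff.contDiffOn (Set.mapsTo_preimage _ _), ?_, ?_⟩
  · rintro y ⟨hyS, hyU⟩
    have hd : DifferentiableAt ℝ f (Φ y) :=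
      (hf.contDiffAt (hU.mem_nhds hyU)).differentiableAt (by simp)
    rw [fderiv_comp y hd Φ.differentiableAt, Φ.fderiv]
    exact (hsurj (Φ y) ⟨hyS, hyU⟩).comp hΦ
  · ext y
    simpa using Set.ext_iff.1 heq (Φ y)

theorem IsNormedSubmanifold.isSubmanifold {F : Type*} [NormedAddCommGroup F] [NormedSpace ℝ F]
    [FiniteDimensional ℝ F] {S : Set F} {d : ℕ} (hS : IsNormedSubmanifold S d) :
    IsSubmanifold S d := by
  obtain ⟨e⟩ := FiniteDimensional.nonempty_linearEquiv_of_finrank_eq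
    (R := ℝ) (M := F) (M' := Fin (Module.finrank ℝ F) → ℝ) (by simp)
  refine ⟨e, ?_⟩
  rw [← LinearEquiv.coe_toEquiv, Equiv.image_eq_preimage_symm]
  exact hS.preimage e.symm.toContinuousLinearEquiv.toContinuousLinearMap e.symm.surjective

theorem IsSubmanifold.preimage {E E' : Type*} [AddCommGroup E] [Module ℝ E]
    [FiniteDimensional ℝ E] [AddCommGroup E'] [Module ℝ E'] {S : Set E'} {d : ℕ}
    (hS : IsSubmanifold S d) (Φ : E →ₗ[ℝ] E') (hΦ : Function.Surjective Φ) :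
    IsSubmanifold (Φ ⁻¹' S) d := by
  obtain ⟨e', he'⟩ := hS
  obtain ⟨e⟩ := FiniteDimensional.nonempty_linearEquiv_of_finrank_eq
    (R := ℝ) (M := E) (M' := Fin (Module.finrank ℝ E) → ℝ) (by simp)
  refine ⟨e, ?_⟩
  have h := he'.preimage
    (LinearMap.toContinuousLinearMap (e'.toLinearMap ∘ₗ Φ ∘ₗ e.symm.toLinearMap))
    (e'.surjective.comp (hΦ.comp e.symm.surjective))
  convert h using 1
  rw [← LinearEquiv.coe_toEquiv, Equiv.image_eq_preimage_symm]
  ext y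
  simp

/-! ### Rank strata of the endomorphisms of a vector space over a division algebra -/

section Slice

variable {C : Type*} [NormedRing C] [NormedAlgebra ℝ C] [FiniteDimensional ℝ C]

/-- Local equation of a rank stratum near `L₀`. Here `M` is a generalized inverse of `L₀`, so that
`p = 1 - M * L₀` projects onto the kernel of `L₀` and `q = 1 - L₀ * M` along its range, and `κ`
identifies the corner `q C p` with `ℝ ^ d`. The equation is the Schur complement
`q u⁻¹ L p` with `u = 1 + (L - L₀) * M`. As `p * M = 0`, moving `L` in a direction `u X p` leaves
`u` unchanged and changes the equation by `q X p`, so the derivative is surjective on the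
whole domain. -/
theorem exists_slice {L₀ M : C} {d : ℕ} (hM : M * L₀ * M = M)
    (κ : C →ₗ[ℝ] (Fin d → ℝ)) (hκs : Function.Surjective κ)
    (hκ : ∀ X, κ X = 0 ↔ (1 - L₀ * M) * X * (1 - M * L₀) = 0) :
    ∃ U : Set C, IsOpen U ∧ L₀ ∈ U ∧ (∀ L ∈ U, IsUnit (1 + (L - L₀) * M)) ∧
      ∃ f : C → (Fin d → ℝ), ContDiffOn ℝ ∞ f U ∧
        (∀ L ∈ U, Function.Surjective (fderiv ℝ f L)) ∧
        ∀ L ∈ U, f L = κ (Ring.inverse (1 + (L - L₀) * M) * L) := by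
  have : CompleteSpace C := FiniteDimensional.complete ℝ C
  have hpM : (1 - M * L₀) * M = 0 := by rw [sub_mul, one_mul, hM, sub_self]
  have hpp : (1 - M * L₀) * (1 - M * L₀) = 1 - M * L₀ := by
    rw [mul_sub, ← mul_assoc, hpM, zero_mul, mul_one, sub_zero]
  have hκp : ∀ X, κ (X * (1 - M * L₀)) = κ X := fun X ↦ by
    have hX : (X * (1 - M * L₀) - X) * (1 - M * L₀) = 0 := by
      rw [sub_mul, mul_assoc X, hpp, sub_self]
    rw [← sub_eq_zero, ← map_sub, hκ, mul_assoc, hX, mul_zero]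
  have hUo : IsOpen {L : C | IsUnit (1 + (L - L₀) * M)} :=
    Units.isOpen.preimage (by fun_prop : Continuous fun L : C ↦ 1 + (L - L₀) * M)
  have hsm : ContDiffOn ℝ ∞ (fun L : C ↦ κ (Ring.inverse (1 + (L - L₀) * M) * L))
      {L : C | IsUnit (1 + (L - L₀) * M)} := by
    intro L hL
    apply ContDiffAt.contDiffWithinAt
    obtain ⟨u, hu⟩ := hL
    have h1 : ContDiffAt ℝ ∞ (Ring.inverse : C → C) (1 + (L - L₀) * M) := by
      rw [← hu]; exact contDiffAt_ringInverse ℝ u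
    have h2 : ContDiffAt ℝ ∞ (fun L : C ↦ 1 + (L - L₀) * M) L := by fun_prop
    have h3 : ContDiffAt ℝ ∞ (fun L : C ↦ Ring.inverse (1 + (L - L₀) * M)) L :=
      ContDiffAt.comp (g := Ring.inverse) L h1 h2
    exact (LinearMap.toContinuousLinearMap κ).contDiff.contDiffAt.comp L (h3.mul contDiffAt_id)
  refine ⟨_, hUo, by simp, fun L hL ↦ hL, _, hsm, ?_, fun L _ ↦ rfl⟩
  intro L hL v
  obtain ⟨X, rfl⟩ := hκs v
  have hL' : IsUnit (1 + (L - L₀) * M) := hL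
  have hd := ((hsm.contDiffAt (hUo.mem_nhds hL)).differentiableAt (by simp)).hasFDerivAt
  refine ⟨(1 + (L - L₀) * M) * (X * (1 - M * L₀)), ?_⟩
  refine (hd.hasLineDerivAt _).unique ?_
  have key : ∀ t : ℝ, κ (Ring.inverse (1 + (L + t • ((1 + (L - L₀) * M) * (X * (1 - M * L₀)))
      - L₀) * M) * (L + t • ((1 + (L - L₀) * M) * (X * (1 - M * L₀))))) =
      κ (Ring.inverse (1 + (L - L₀) * M) * L) + t • κ X := fun t ↦ by
    have : (1 + (L + t • ((1 + (L - L₀) * M) * (X * (1 - M * L₀))) - L₀) * M) =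
        1 + (L - L₀) * M := by
      rw [add_sub_right_comm, add_mul _ _ M, smul_mul_assoc, mul_assoc, mul_assoc X, hpM]
      simp
    rw [this, mul_add, mul_smul_comm, ← mul_assoc, Ring.inverse_mul_cancel _ hL', one_mul,
      map_add, map_smul, hκp]
  unfold HasLineDerivAt
  simp only [key]
  simpa using ((hasDerivAt_id (0 : ℝ)).smul_const (κ X)).const_add
    (κ (Ring.inverse (1 + (L - L₀) * M) * L))

end Slice

section Rank


variable {D W : Type*} [DivisionRing D] [AddCommGroup W] [Module D W]

theorem exists_generalized_inverse (L : End D W) :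
    ∃ M : End D W, L * M * L = L ∧ M * L * M = M := by
  obtain ⟨r, hr⟩ := L.rangeRestrict.exists_rightInverse_of_surjective L.range_rangeRestrict
  obtain ⟨π, hπ⟩ := (LinearMap.range L).subtype.exists_leftInverse_of_injective
    (LinearMap.range L).ker_subtype
  have hr' : ∀ y, L (r y) = y := fun y ↦ congrArg Subtype.val (LinearMap.congr_fun hr y)
  have hπ' : ∀ y : LinearMap.range L, π y = y := fun y ↦ LinearMap.congr_fun hπ y
  refine ⟨r ∘ₗ π, ?_, ?_⟩
  · ext x
    simpa [hr'] using congrArg Subtype.val (hπ' ⟨L x, x, rfl⟩)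
  · ext x
    simp [hr', hπ']

theorem finrank_ker_mul_of_isUnit [FiniteDimensional D W] (a : End D W) {u : End D W}
    (hu : IsUnit u) : finrank D (LinearMap.ker (a * u)) = finrank D (LinearMap.ker a) := by
  obtain ⟨u, rfl⟩ := hu
  let e := LinearMap.GeneralLinearGroup.toLinearEquiv u
  have : LinearMap.ker (a * (u : End D W)) = (LinearMap.ker a).comap (e : W →ₗ[D] W) := rfl
  rw [this]
  rw [(e.submoduleMap _).finrank_eq]
  exact congrArg (fun K : Submodule D W ↦ finrank D K)
    (Submodule.map_comap_eq_of_surjective e.surjective _)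

theorem ker_mul_of_isUnit (a : End D W) {u : End D W} (hu : IsUnit u) :
    LinearMap.ker (u * a) = LinearMap.ker a := by
  obtain ⟨u, rfl⟩ := hu
  ext x
  refine ⟨fun h ↦ ?_, fun h ↦ ?_⟩
  · have : ((u⁻¹ : (End D W)ˣ) : End D W) ((u : End D W) (a x)) = 0 := by
      rw [show (u : End D W) (a x) = 0 from h, map_zero]
    rwa [← Module.End.mul_apply, Units.inv_mul] at this
  · simp_all

/-- The Schur complement of `exists_slice` vanishes exactly where the corank is that of `L₀`: with
`L' = u⁻¹ L` one has `L' = L₀ + L' p`, hence `L' (1 - M L' p) = L₀ + q L' p`. The second factor on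
the left is unipotent, and the kernel of the right side lies in that of `L₀`, with equality if and
only if `q L' p = 0`. -/
theorem finrank_ker_eq_iff_of_slice [FiniteDimensional D W] {L₀ M L : End D W}
    (h₁ : L₀ * M * L₀ = L₀) (h₂ : M * L₀ * M = M) (hL : IsUnit (1 + (L - L₀) * M)) :
    finrank D (LinearMap.ker L) = finrank D (LinearMap.ker L₀) ↔
      (1 - L₀ * M) * (Ring.inverse (1 + (L - L₀) * M) * L) * (1 - M * L₀) = 0 := by
  set u := 1 + (L - L₀) * M with hu
  set L' := Ring.inverse u * L with hL'
  set p := 1 - M * L₀ with hp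
  set q := 1 - L₀ * M with hq
  have hpM : p * M = 0 := by rw [hp, sub_mul, one_mul, h₂, sub_self]
  have hMq : M * q = 0 := by rw [hq, mul_sub, ← mul_assoc, h₂, mul_one, sub_self]
  have hL₀p : L₀ * p = 0 := by rw [hp, mul_sub, ← mul_assoc, h₁, mul_one, sub_self]
  have huL' : u * L' = L := by rw [hL', ← mul_assoc, Ring.mul_inverse_cancel _ hL, one_mul]
  have hker : LinearMap.ker L = LinearMap.ker L' := by
    rw [← huL', ker_mul_of_isUnit _ hL]
  clear_value L'
  have hdec : L' = L₀ + L' * p := by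
    have h : u * L₀ = u * (L' - L' * p) := by
      rw [mul_sub, ← mul_assoc u, huL', hu, hp, add_mul, mul_assoc, sub_mul, ← mul_assoc L₀, h₁]
      noncomm_ring
    exact (sub_eq_iff_eq_add.1 (hL.mul_left_cancel h).symm)
  clear_value p
  set g := q * L' * p with hg
  have hnil : (1 - M * L' * p) * (1 + M * L' * p) = 1 ∧
      (1 + M * L' * p) * (1 - M * L' * p) = 1 := by
    have : (M * L' * p) * (M * L' * p) = 0 := by
      rw [mul_assoc (M * L'), ← mul_assoc p, ← mul_assoc p, hpM]; simp
    constructor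
    · rw [sub_mul, mul_add, mul_add, this]; simp
    · rw [add_mul, mul_sub, mul_sub, this]; simp
  have hunit : IsUnit (1 - M * L' * p) := ⟨⟨_, _, hnil.1, hnil.2⟩, rfl⟩
  have hfac : L' * (1 - M * L' * p) = L₀ + g := by
    have hz : L' * p * (M * L' * p) = 0 := by
      rw [mul_assoc M, mul_assoc L', ← mul_assoc p, hpM]; simp
    calc L' * (1 - M * L' * p) = (L₀ + L' * p) * (1 - M * L' * p) := congrArg (· * _) hdec
      _ = L₀ - L₀ * M * L' * p + L' * p - L' * p * (M * L' * p) := by noncomm_ring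
      _ = L₀ + g := by rw [hz, hg, hq]; noncomm_ring
  have hle : LinearMap.ker (L₀ + g) ≤ LinearMap.ker L₀ := by
    intro x hx
    have h : (L₀ * M) * (L₀ + g) = L₀ := by
      rw [mul_add, h₁, hg, mul_assoc L₀, ← mul_assoc M, ← mul_assoc M, hMq]; simp
    rw [LinearMap.mem_ker] at hx ⊢
    rw [← h, Module.End.mul_apply, hx, map_zero]
  rw [hker, ← finrank_ker_mul_of_isUnit L' hunit, hfac]
  refine ⟨fun h ↦ ?_, fun h ↦ by rw [h, add_zero]⟩
  have heq := Submodule.eq_of_le_of_finrank_eq hle h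
  have hgp : g * p = g := by
    have hpp : p * p = p := by
      conv_lhs => rw [hp, mul_sub, ← mul_assoc, ← hp, hpM]
      simp
    rw [hg, mul_assoc, hpp]
  ext x
  have hx : p x ∈ LinearMap.ker (L₀ + g) := by
    rw [heq, LinearMap.mem_ker, ← Module.End.mul_apply, hL₀p, LinearMap.zero_apply]
  have hx' : L₀ (p x) = 0 := by rw [← Module.End.mul_apply, hL₀p, LinearMap.zero_apply]
  rw [LinearMap.mem_ker, LinearMap.add_apply, hx', zero_add, ← Module.End.mul_apply, hgp] at hx
  rw [hx, LinearMap.zero_apply]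

variable [Algebra ℝ D] [Module ℝ W] [IsScalarTower ℝ D W] [SMulCommClass D ℝ W]

theorem finrank_real_linearMap {K K' : Type*} [AddCommGroup K] [Module D K] [FiniteDimensional D K]
    [AddCommGroup K'] [Module D K'] [FiniteDimensional D K'] [Module ℝ K'] [IsScalarTower ℝ D K']
    [SMulCommClass D ℝ K'] :
    finrank ℝ (K →ₗ[D] K') = finrank D K * finrank D K' * finrank ℝ D := by
  rw [← ((Module.finBasis D K).constr (M' := K') ℝ).finrank_eq]
  have := Module.finrank_mul_finrank ℝ D (Fin (finrank D K) → K')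
  rw [← this, Module.finrank_pi_fintype]
  simp [mul_comm]

/-- The endomorphisms of corank `i` form a submanifold: its local equations take values in the maps
over `D` from the kernel of `L₀` to a complement of the range, a real space of dimension
`i ^ 2 * dim D`. -/
theorem isSubmanifold_finrank_ker [FiniteDimensional ℝ D] [FiniteDimensional D W] (i : ℕ) :
    IsSubmanifold {L : End D W | finrank D (LinearMap.ker L) = i} (i ^ 2 * finrank ℝ D) := by
  classical
  have : FiniteDimensional ℝ W := FiniteDimensional.trans ℝ D W
  -- A submultiplicative norm, pulled back along the regular representation, makes
  -- inversion smooth.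
  let φ := Algebra.leftMulMatrix (Module.finBasis ℝ (End D W))
  have hφ : Function.Injective φ := Algebra.leftMulMatrix_injective _
  let := Matrix.linftyOpNormedRing (n := Fin (finrank ℝ (End D W))) (α := ℝ)
  let := Matrix.linftyOpNormedAlgebra (n := Fin (finrank ℝ (End D W))) (α := ℝ) (R := ℝ)
  let : NormedRing (End D W) := NormedRing.induced _ _ φ hφ
  let : NormedAlgebra ℝ (End D W) := NormedAlgebra.induced ℝ _ _ φ
  refine IsNormedSubmanifold.isSubmanifold (F := End D W) ?_
  intro L₀ hL₀
  obtain ⟨M, h₁, h₂⟩ := exists_generalized_inverse L₀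
  let q : End D W := 1 - L₀ * M
  let p : End D W := 1 - M * L₀
  have hL₀p : L₀ * p = 0 := by
    change L₀ * (1 - M * L₀) = 0
    rw [mul_sub, ← mul_assoc, h₁, mul_one, sub_self]
  have hqL₀ : q * L₀ = 0 := by
    change (1 - L₀ * M) * L₀ = 0
    rw [sub_mul, h₁, one_mul, sub_self]
  have hq : finrank D (LinearMap.range q) = i := by
    have hk : LinearMap.ker q = LinearMap.range L₀ := by
      ext w
      constructor
      · intro hw
        refine ⟨M w, ?_⟩
        have : w - L₀ (M w) = 0 := hw
        exact (sub_eq_zero.1 this).symm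
      · rintro ⟨v, rfl⟩
        exact LinearMap.congr_fun hqL₀ v
    have e₁ := LinearMap.finrank_range_add_finrank_ker q
    have e₂ := LinearMap.finrank_range_add_finrank_ker L₀
    have e₃ : finrank D (LinearMap.ker L₀) = i := hL₀
    rw [hk] at e₁
    omega
  -- `Θ` is the corner map `X ↦ q X p`, seen as a map from `ker L₀` to `range q`.
  let Θ : End D W →ₗ[ℝ] (LinearMap.ker L₀ →ₗ[D] LinearMap.range q) :=
    { toFun := fun X ↦ q.rangeRestrict ∘ₗ X ∘ₗ (LinearMap.ker L₀).subtype
      map_add' := fun X Y ↦ by ext; simp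
      map_smul' := fun c X ↦ by
        ext x
        simp [LinearMap.map_smul_of_tower] }
  have hΘs : Function.Surjective Θ := by
    intro g
    refine ⟨(LinearMap.range q).subtype ∘ₗ g ∘ₗ p.codRestrict (LinearMap.ker L₀)
      (fun w ↦ LinearMap.congr_fun hL₀p w), ?_⟩
    ext x
    have hx : p.codRestrict (LinearMap.ker L₀) (fun w ↦ LinearMap.congr_fun hL₀p w) x = x := by
      ext
      have : L₀ x = 0 := x.2
      change (x : W) - M (L₀ x) = x
      rw [this, map_zero, sub_zero]
    have hqq : ∀ y ∈ LinearMap.range q, q y = y := by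
      rintro _ ⟨w, rfl⟩
      have : q * q = q := by
        change q * (1 - L₀ * M) = q
        rw [mul_sub, ← mul_assoc, hqL₀, zero_mul, mul_one, sub_zero]
      exact LinearMap.congr_fun this w
    change q (g (p.codRestrict (LinearMap.ker L₀) (fun w ↦ LinearMap.congr_fun hL₀p w) x)) = g x
    rw [hx, hqq _ (g x).2]
  have hΘ : ∀ X, Θ X = 0 ↔ q * X * p = 0 := by
    intro X
    constructor
    · intro h
      ext w
      exact congrArg Subtype.val
        (LinearMap.congr_fun h ⟨p w, LinearMap.congr_fun hL₀p w⟩)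
    · intro h
      ext x
      have hx : p x = x := by
        have : L₀ x = 0 := x.2
        change (x : W) - M (L₀ x) = x
        rw [this, map_zero, sub_zero]
      have := LinearMap.congr_fun h x
      change q (X (p x)) = 0 at this
      rw [hx] at this
      exact this
  have hdim : finrank ℝ (LinearMap.ker L₀ →ₗ[D] LinearMap.range q) = i ^ 2 * finrank ℝ D := by
    have e₃ : finrank D (LinearMap.ker L₀) = i := hL₀
    rw [finrank_real_linearMap, hq, e₃, sq]
  have : FiniteDimensional ℝ (LinearMap.ker L₀ →ₗ[D] LinearMap.range q) :=
    Module.Finite.of_surjective Θ hΘs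
  obtain ⟨e⟩ := FiniteDimensional.nonempty_linearEquiv_of_finrank_eq
    (R := ℝ) (M := LinearMap.ker L₀ →ₗ[D] LinearMap.range q)
    (M' := Fin (i ^ 2 * finrank ℝ D) → ℝ) (by simp [hdim])
  obtain ⟨U, hU, hL₀U, hunit, f, hf, hsurj, hfκ⟩ :=
    exists_slice (C := End D W) h₂ (e.toLinearMap ∘ₗ Θ) (e.surjective.comp hΘs)
      (fun X ↦ by simpa using hΘ X)
  refine ⟨U, hU, hL₀U, f, hf, fun y hy ↦ hsurj y hy.2, ?_⟩
  ext L
  simp only [Set.mem_inter_iff, Set.mem_ofPred_eq]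
  rw [and_comm]
  refine and_congr_right fun hL ↦ ?_
  have e₃ : finrank D (LinearMap.ker L₀) = i := hL₀
  have := finrank_ker_eq_iff_of_slice h₁ h₂ (hunit L hL)
  rw [e₃] at this
  rw [hfκ L hL, this]
  simpa using (hΘ _).symm

end Rank

/-! ### Matrices whose powers are independent and have trace zero -/

/-- The derivative of `a ↦ τ (a ^ (k + 1))` at `b` is `(k + 1) τ (b ^ k * ·)`. For a nondegenerate
trace form `τ`, these functionals are independent as soon as the powers of `b` are. -/
theorem isNormedSubmanifold_linearIndependent_pow {C : Type*} [NormedRing C] [NormedAlgebra ℝ C]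
    (τ : C →L[ℝ] ℝ) (hτ : ∀ a b, τ (a * b) = τ (b * a)) (hτ' : ∀ a, (∀ b, τ (a * b) = 0) → a = 0)
    (s : ℕ) :
    IsNormedSubmanifold {a : C | LinearIndependent ℝ (fun k : Fin s ↦ a ^ (k : ℕ)) ∧
        ∀ k : Fin s, τ (a ^ ((k : ℕ) + 1)) = 0} s := by
  intro a ha
  refine ⟨{b | LinearIndependent ℝ (fun k : Fin s ↦ b ^ (k : ℕ))}, ?_, ha.1,
    fun b k ↦ τ (b ^ ((k : ℕ) + 1)), ?_, ?_, ?_⟩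
  · exact isOpen_setOfPred_linearIndependent.preimage
      (f := fun (b : C) (k : Fin s) ↦ b ^ (k : ℕ)) (by fun_prop)
  · refine ContDiff.contDiffOn (contDiff_pi.2 fun k ↦ ?_)
    exact τ.contDiff.comp (contDiff_id.pow _)
  · rintro b ⟨-, hb⟩
    have hder : ∀ k : Fin s, HasFDerivAt (fun b ↦ τ (b ^ ((k : ℕ) + 1)))
        (τ ∘L _) b := fun k ↦ τ.hasFDerivAt.comp b (hasFDerivAt_pow' (𝕜 := ℝ) _)
    have hval : ∀ h k, fderiv ℝ (fun (b : C) (k : Fin s) ↦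
        τ (b ^ ((k : ℕ) + 1))) b h k = ((k : ℕ) + 1) * τ (b ^ (k : ℕ) * h) := fun h k ↦ by
      rw [(hasFDerivAt_pi.2 hder).fderiv]
      simp only [ContinuousLinearMap.coe_pi', ContinuousLinearMap.comp_apply,
        sum_apply, map_sum, smul_apply,
        ContinuousLinearMap.id_apply, MulOpposite.smul_eq_mul_unop, MulOpposite.unop_op,
        smul_eq_mul, Nat.pred_eq_sub_one, Nat.add_sub_cancel]
      rw [Finset.sum_congr rfl (g := fun _ ↦ τ (b ^ (k : ℕ) * h)) ?_]
      · simp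
      · intro j hj
        have hj : j ≤ k := Nat.lt_succ_iff.1 (Finset.mem_range.1 hj)
        rw [hτ, ← mul_assoc, ← pow_add, Nat.add_sub_cancel' hj]
    set Φ := fderiv ℝ (fun (b : C) (k : Fin s) ↦ τ (b ^ ((k : ℕ) + 1))) b
    -- A functional vanishing on the range gives a relation between the powers of `b`.
    change Function.Surjective (Φ : C →ₗ[ℝ] (Fin s → ℝ))
    rw [← LinearMap.dualMap_injective_iff, injective_iff_map_eq_zero]
    intro φ hφ
    have hsum : ∑ k : Fin s, (φ (Pi.single k 1) * ((k : ℕ) + 1)) • b ^ (k : ℕ) = 0 := by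
      refine hτ' _ fun h ↦ ?_
      have h0 : φ (Φ h) = 0 := LinearMap.congr_fun hφ h
      rw [LinearMap.pi_apply_eq_sum_univ φ] at h0
      rw [← h0, Finset.sum_mul, map_sum]
      refine Finset.sum_congr rfl fun k _ ↦ ?_
      rw [smul_mul_assoc, map_smul, hval, smul_eq_mul, smul_eq_mul,
        show (fun j ↦ if k = j then (1 : ℝ) else 0) = Pi.single k 1 by
          ext j; simp [Pi.single_apply, eq_comm]]
      ring
    have hc := Fintype.linearIndependent_iff.1 hb _ hsum
    refine LinearMap.pi_ext' fun k ↦ LinearMap.ext_ring ?_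
    have hk : ((k : ℕ) : ℝ) + 1 ≠ 0 := by positivity
    simpa [hk] using hc k
  · ext b
    simp only [Set.mem_inter_iff, Set.mem_ofPred_eq, funext_iff, Pi.zero_apply]
    tauto

theorem isSubmanifold_linearIndependent_pow_trace (s : ℕ) :
    IsSubmanifold {A : Matrix (Fin s) (Fin s) ℝ |
      LinearIndependent ℝ (fun k : Fin s ↦ A ^ (k : ℕ)) ∧
        ∀ k : Fin s, (A ^ ((k : ℕ) + 1)).trace = 0} s := by
  let := Matrix.linftyOpNormedRing (n := Fin s) (α := ℝ)
  let := Matrix.linftyOpNormedAlgebra (n := Fin s) (α := ℝ) (R := ℝ)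
  refine IsNormedSubmanifold.isSubmanifold (F := Matrix (Fin s) (Fin s) ℝ) ?_
  refine isNormedSubmanifold_linearIndependent_pow
    (LinearMap.toContinuousLinearMap (Matrix.traceLinearMap (Fin s) ℝ ℝ))
    Matrix.trace_mul_comm (fun A hA ↦ ?_) s
  rw [Matrix.ext_iff_trace_mul_right]
  intro B
  rw [zero_mul, Matrix.trace_zero]
  exact hA B

theorem finrank_ker_mul_le {K W : Type*} [DivisionRing K] [AddCommGroup W] [Module K W]
    [FiniteDimensional K W] (a b : End K W) :
    finrank K (LinearMap.ker (a * b)) ≤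
      finrank K (LinearMap.ker a) + finrank K (LinearMap.ker b) := by
  let c : LinearMap.ker (a * b) →ₗ[K] LinearMap.ker a := b.restrict fun x hx ↦ hx
  have h₁ := LinearMap.finrank_range_add_finrank_ker c
  have h₂ : finrank K (LinearMap.range c) ≤ finrank K (LinearMap.ker a) := Submodule.finrank_le _
  have h₃ : finrank K (LinearMap.ker c) ≤ finrank K (LinearMap.ker b) := by
    refine LinearMap.finrank_le_finrank_of_injective (f := ((LinearMap.ker (a * b)).subtype.restrict
      (p := LinearMap.ker c) (q := LinearMap.ker b) fun x hx ↦ congrArg Subtype.val hx)) ?_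
    intro x y hxy
    exact Subtype.ext (Subtype.ext (congrArg (fun z : LinearMap.ker b ↦ (z : W)) hxy))
  omega

theorem finrank_ker_pow_le {K W : Type*} [DivisionRing K] [AddCommGroup W] [Module K W]
    [FiniteDimensional K W] {a : End K W} (ha : finrank K (LinearMap.ker a) ≤ 1) (k : ℕ) :
    finrank K (LinearMap.ker (a ^ k)) ≤ k := by
  induction k with
  | zero =>
    rw [pow_zero, Module.End.one_eq_id, LinearMap.ker_id, finrank_bot]
  | succ k ih => rw [pow_succ]; exact (finrank_ker_mul_le _ _).trans (by omega)

/-- The minimal polynomial of a nilpotent element is a power of `X`, here of degree at least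
`s + 1`. -/
theorem linearIndependent_pow_of_isNilpotent {K C : Type*} [Field K] [Ring C] [Algebra K C]
    {a : C} (ha : IsNilpotent a) {s : ℕ} (hs : a ^ s ≠ 0) :
    LinearIndependent K (fun k : Fin (s + 1) ↦ a ^ (k : ℕ)) := by
  obtain ⟨n, hn⟩ := ha
  have hdvd : minpoly K a ∣ Polynomial.X ^ n := minpoly.dvd K a (by simpa using hn)
  obtain ⟨m, -, hm⟩ := (dvd_prime_pow Polynomial.prime_X n).1 hdvd
  have hint : IsIntegral K a := ⟨Polynomial.X ^ n, Polynomial.monic_X_pow n, by simpa using hn⟩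
  have hmin : minpoly K a = Polynomial.X ^ m :=
    Polynomial.eq_of_monic_of_associated (minpoly.monic hint) (Polynomial.monic_X_pow m) hm
  have ham : a ^ m = 0 := by simpa [hmin] using minpoly.aeval K a
  have hle : s + 1 ≤ (minpoly K a).natDegree := by
    rw [hmin, Polynomial.natDegree_X_pow]
    by_contra h
    exact hs (pow_eq_zero_of_le (by omega) ham)
  exact (linearIndependent_pow (K := K) a).comp (Fin.castLE hle) (Fin.castLE_injective hle)

/-! ### Real division algebras of finite dimension -/

section Frobenius

variable {D : Type*} [DivisionRing D] [Algebra ℝ D] [FiniteDimensional ℝ D]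

/-- Every element of a real division algebra of finite dimension is real or, after an affine
change, a square root of `-1`. -/
theorem exists_eq_algebraMap_or_sq_eq_neg_one (x : D) :
    (∃ a : ℝ, x = algebraMap ℝ D a) ∨
      ∃ (a b : ℝ) (j : D), x = algebraMap ℝ D a + b • j ∧ j * j = -1 := by
  have hint : IsIntegral ℝ x := Algebra.IsIntegral.isIntegral x
  have hirr := minpoly.irreducible hint
  have h0 := minpoly.aeval ℝ x
  have hmon := minpoly.monic hint
  set P := minpoly ℝ x
  -- Multiplying by `X` if the degree is one, a monic quadratic polynomial vanishes at `x`.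
  obtain ⟨b, c, hbc⟩ : ∃ b c : ℝ, x * x + b • x + algebraMap ℝ D c = 0 := by
    have hdeg : P.natDegree ≤ 2 := Polynomial.natDegree_le_of_degree_le hirr.degree_le_two
    have hpos : 0 < P.natDegree := minpoly.natDegree_pos hint
    rw [Polynomial.eq_quadratic_of_degree_le_two hirr.degree_le_two] at h0
    simp only [map_add, map_mul, Polynomial.aeval_C, Polynomial.aeval_X, map_pow,
      ← Algebra.smul_def] at h0
    obtain h | h : P.natDegree = 2 ∨ P.natDegree = 1 := by omega
    · have h2 : P.coeff 2 = 1 := by rw [← h]; exact hmon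
      refine ⟨P.coeff 1, P.coeff 0, ?_⟩
      rw [← h0, h2, one_smul, sq]
    · have h1 : P.coeff 1 = 1 := by rw [← h]; exact hmon
      have h2 : P.coeff 2 = 0 := Polynomial.coeff_eq_zero_of_natDegree_lt (by omega)
      rw [h1, h2, zero_smul, zero_add, one_smul] at h0
      refine ⟨P.coeff 0, 0, ?_⟩
      rw [map_zero, add_zero, Algebra.smul_def, ← add_mul, h0, zero_mul]
  have hsq : (x + algebraMap ℝ D (b / 2)) * (x + algebraMap ℝ D (b / 2)) =
      algebraMap ℝ D (b ^ 2 / 4 - c) := by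
    have hcomm : algebraMap ℝ D (b / 2) * x = x * algebraMap ℝ D (b / 2) := Algebra.commutes _ _
    have e1 : x * algebraMap ℝ D (b / 2) + x * algebraMap ℝ D (b / 2) = b • x := by
      rw [← mul_add, ← map_add, add_halves, ← Algebra.commutes, Algebra.smul_def]
    have e2 : algebraMap ℝ D (b / 2) * algebraMap ℝ D (b / 2) = algebraMap ℝ D (b ^ 2 / 4) := by
      rw [← map_mul]; congr 1; ring
    calc _ = x * x + (x * algebraMap ℝ D (b / 2) + algebraMap ℝ D (b / 2) * x) +
          algebraMap ℝ D (b / 2) * algebraMap ℝ D (b / 2) := by noncomm_ring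
      _ = (x * x + b • x + algebraMap ℝ D c) + (algebraMap ℝ D (b ^ 2 / 4) - algebraMap ℝ D c) := by
          rw [hcomm, e1, e2]; abel
      _ = _ := by rw [hbc, zero_add, map_sub]
  set r := b ^ 2 / 4 - c
  rcases le_or_gt 0 r with hr | hr
  · left
    have hfac : (x + algebraMap ℝ D (b / 2)) * (x + algebraMap ℝ D (b / 2)) =
        algebraMap ℝ D (√r) * algebraMap ℝ D (√r) := by
      rw [hsq, ← map_mul, Real.mul_self_sqrt hr]
    rcases (Commute.mul_self_eq_mul_self_iff
      (show Commute (x + algebraMap ℝ D (b / 2)) (algebraMap ℝ D √r) from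
        (Algebra.commutes _ _).symm)).1 hfac with h | h
    · exact ⟨√r - b / 2, by rw [map_sub, ← h, add_sub_cancel_right]⟩
    · exact ⟨-√r - b / 2, by rw [map_sub, map_neg, ← h, add_sub_cancel_right]⟩
  · right
    have hs : √(-r) ≠ 0 := (Real.sqrt_pos.2 (neg_pos.2 hr)).ne'
    refine ⟨-(b / 2), √(-r), (√(-r))⁻¹ • (x + algebraMap ℝ D (b / 2)), ?_, ?_⟩
    · rw [smul_smul, mul_inv_cancel₀ hs, one_smul, map_neg]; abel
    · rw [smul_mul_smul_comm, hsq, ← mul_inv, Real.mul_self_sqrt (neg_pos.2 hr).le,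
        Algebra.algebraMap_eq_smul_one, smul_smul, inv_neg, neg_mul, inv_mul_cancel₀ hr.ne,
        neg_smul, one_smul]

/-- The dimension part of the theorem of Frobenius. If `D` is not `ℝ`, it contains a square root `i`
of `-1`. The centralizer `P` of `i` is spanned by `1` and `i`, because a square root of `-1` that
commutes with `i` is `± i`. Conjugation by `i` splits `D` into `P` and the elements `N` that
anticommute with `i`, and multiplication by a nonzero element of `N` exchanges `P` and `N`. -/
theorem finrank_divisionRing_eq_one_or_two_or_four :
    finrank ℝ D = 1 ∨ finrank ℝ D = 2 ∨ finrank ℝ D = 4 := by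
  by_cases hreal : ∀ x : D, ∃ a : ℝ, x = algebraMap ℝ D a
  · left
    refine finrank_eq_one (1 : D) one_ne_zero fun w ↦ ?_
    obtain ⟨a, rfl⟩ := hreal w
    exact ⟨a, (Algebra.algebraMap_eq_smul_one a).symm⟩
  push Not at hreal
  obtain ⟨x₀, hx₀⟩ := hreal
  obtain ⟨i, hi⟩ : ∃ i : D, i * i = -1 := by
    rcases exists_eq_algebraMap_or_sq_eq_neg_one x₀ with ⟨a, ha⟩ | ⟨_, _, i, _, hi⟩
    · exact absurd ha (hx₀ a)
    · exact ⟨i, hi⟩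
  have hi0 : i ≠ 0 := by rintro rfl; simp at hi
  right
  let P : Submodule ℝ D := LinearMap.ker (LinearMap.mulRight ℝ i - LinearMap.mulLeft ℝ i)
  let N : Submodule ℝ D := LinearMap.ker (LinearMap.mulRight ℝ i + LinearMap.mulLeft ℝ i)
  have hP : ∀ x, x ∈ P ↔ x * i = i * x := fun x ↦ by
    simp [P, LinearMap.mem_ker, sub_eq_zero]
  have hN : ∀ x, x ∈ N ↔ x * i = -(i * x) := fun x ↦ by
    simp [N, LinearMap.mem_ker, add_eq_zero_iff_eq_neg]
  have hPN : IsCompl P N := by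
    refine IsCompl.of_eq ?_ ?_
    · rw [Submodule.eq_bot_iff]
      rintro x ⟨h₁, h₂⟩
      have h₁ := (hP x).1 h₁
      have h₂ := (hN x).1 h₂
      rw [h₁, eq_neg_iff_add_eq_zero, ← two_smul ℝ, smul_eq_zero] at h₂
      rcases h₂ with h | h
      · norm_num at h
      · exact (mul_eq_zero.1 h).resolve_left hi0
    · rw [Submodule.eq_top_iff']
      intro x
      rw [Submodule.mem_sup]
      refine ⟨(2⁻¹ : ℝ) • (x - i * x * i), (hP _).2 ?_,
        (2⁻¹ : ℝ) • (x + i * x * i), (hN _).2 ?_, ?_⟩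
      · rw [smul_mul_assoc, mul_smul_comm, sub_mul, mul_sub, mul_assoc (i * x), hi, mul_assoc i x i,
          ← mul_assoc i i, hi]
        simp only [mul_neg, mul_one, neg_mul, one_mul]
        congr 1; abel
      · rw [smul_mul_assoc, mul_smul_comm, add_mul, mul_add, mul_assoc (i * x), hi, mul_assoc i x i,
          ← mul_assoc i i, hi, ← smul_neg]
        simp only [mul_neg, mul_one, neg_mul, one_mul]
        congr 1; abel
      · rw [← smul_add, show x - i * x * i + (x + i * x * i) = (2 : ℝ) • x by rw [two_smul]; abel,
          smul_smul]
        norm_num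
  have hPdim : finrank ℝ P = 2 := by
    have hspan : P = Submodule.span ℝ (Set.range ![(1 : D), i]) := by
      apply le_antisymm
      · intro x hx
        have hx := (hP x).1 hx
        rw [Matrix.range_cons, Matrix.range_cons, Matrix.range_empty, Set.union_empty,
          Set.singleton_union, Submodule.mem_span_pair]
        rcases exists_eq_algebraMap_or_sq_eq_neg_one x with ⟨a, rfl⟩ | ⟨a, b, j, rfl, hj⟩
        · exact ⟨a, 0, by rw [zero_smul, add_zero, Algebra.algebraMap_eq_smul_one]⟩
        · rcases eq_or_ne b 0 with rfl | hb
          · exact ⟨a, 0, by rw [zero_smul, zero_smul, Algebra.algebraMap_eq_smul_one]⟩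
          · have hji : j * i = i * j := by
              rw [add_mul, mul_add, Algebra.commutes, add_right_inj, smul_mul_assoc,
                mul_smul_comm] at hx
              exact smul_right_injective D hb hx
            rcases (Commute.mul_self_eq_mul_self_iff hji).1 (hj.trans hi.symm) with rfl | rfl
            · exact ⟨a, b, by rw [Algebra.algebraMap_eq_smul_one]⟩
            · exact ⟨a, -b, by rw [Algebra.algebraMap_eq_smul_one, neg_smul, smul_neg]⟩
      · rw [Submodule.span_le]
        rintro _ ⟨k, rfl⟩
        fin_cases k
        · exact (hP _).2 (by simp)
        · exact (hP _).2 rfl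
    have hli : LinearIndependent ℝ ![(1 : D), i] := by
      rw [LinearIndependent.pair_iff]
      intro a b hab
      have hb : b = 0 := by
        by_contra hb
        have hi' : i = algebraMap ℝ D (-(b⁻¹ * a)) := by
          rw [Algebra.algebraMap_eq_smul_one, neg_smul, mul_smul, ← smul_neg,
            eq_comm, inv_smul_eq_iff₀ hb, ← sub_eq_zero, ← neg_eq_zero]
          rw [← hab]; abel
        rw [hi', ← map_mul, ← map_one (algebraMap ℝ D), ← map_neg] at hi
        have := (algebraMap ℝ D).injective hi
        nlinarith [mul_self_nonneg (-(b⁻¹ * a))]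
      subst hb
      simpa using hab
    rw [hspan, finrank_span_eq_card hli, Fintype.card_fin]
  have hsum := Submodule.finrank_add_eq_of_isCompl hPN
  by_cases hN0 : N = ⊥
  · left
    rw [hN0, finrank_bot] at hsum
    omega
  · right
    obtain ⟨y, hy, hy0⟩ := Submodule.exists_mem_ne_zero_of_ne_bot hN0
    have hy := (hN y).1 hy
    have hinj : Function.Injective (LinearMap.mulLeft ℝ y) := mul_right_injective₀ hy0
    have h₁ : finrank ℝ N ≤ finrank ℝ P := by
      refine LinearMap.finrank_le_finrank_of_injective
        (f := (LinearMap.mulLeft ℝ y).restrict (p := N) (q := P) fun x hx ↦ ?_) ?_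
      · have hx := (hN x).1 hx
        rw [hP, LinearMap.mulLeft_apply, mul_assoc, hx, mul_neg, ← mul_assoc, hy, neg_mul, neg_neg,
          mul_assoc]
      · intro a b hab
        exact Subtype.ext (hinj (congrArg Subtype.val hab))
    have h₂ : finrank ℝ P ≤ finrank ℝ N := by
      refine LinearMap.finrank_le_finrank_of_injective
        (f := (LinearMap.mulLeft ℝ y).restrict (p := P) (q := N) fun x hx ↦ ?_) ?_
      · have hx := (hP x).1 hx
        rw [hN, LinearMap.mulLeft_apply, mul_assoc, hx, ← mul_assoc, hy, neg_mul, mul_assoc]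
      · intro a b hab
        exact Subtype.ext (hinj (congrArg Subtype.val hab))
    omega

end Frobenius

/-! ### Algebras in which every element is a unit or nilpotent -/

section LocalAlgebra

variable {A : Type*} [Ring A]

theorem not_isUnit_mul_of_isNilpotent [Nontrivial A] {a : A} (ha : IsNilpotent a) (b : A) :
    ¬ IsUnit (a * b) ∧ ¬ IsUnit (b * a) := by
  obtain ⟨n, hn⟩ := ha
  constructor
  · rintro ⟨u, hu⟩
    have h : a * (b * ↑u⁻¹) = 1 := by rw [← mul_assoc, ← hu, Units.mul_inv]
    simpa [hn] using pow_mul_pow_eq_one n h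
  · rintro ⟨u, hu⟩
    have h : (↑u⁻¹ * b) * a = 1 := by rw [mul_assoc, ← hu, Units.inv_mul]
    simpa [hn] using pow_mul_pow_eq_one n h

theorem isNilpotent_add_of_isUnit_or [Nontrivial A] (hA : ∀ a : A, IsUnit a ∨ IsNilpotent a)
    {a b : A} (ha : IsNilpotent a) (hb : IsNilpotent b) : IsNilpotent (a + b) := by
  refine (hA _).resolve_left fun ⟨u, hu⟩ ↦ ?_
  have h : ↑u⁻¹ * b = 1 - ↑u⁻¹ * a := by
    rw [eq_sub_iff_add_eq, ← mul_add, add_comm b a, ← hu, Units.inv_mul]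
  refine (not_isUnit_mul_of_isNilpotent hb (↑u⁻¹ : A)).2 ?_
  rw [h]
  exact ((hA _).resolve_left (not_isUnit_mul_of_isNilpotent ha _).2).isUnit_one_sub

/-- The nilpotent elements of a ring in which all other elements are units, as an ideal. -/
def nilIdeal [Nontrivial A] (hA : ∀ a : A, IsUnit a ∨ IsNilpotent a) : Ideal A where
  carrier := {a | IsNilpotent a}
  zero_mem' := IsNilpotent.zero
  add_mem' := isNilpotent_add_of_isUnit_or hA
  smul_mem' b _ ha := (hA _).resolve_left (not_isUnit_mul_of_isNilpotent ha b).2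

/-- The residue division algebra of an algebra whose elements are units or nilpotent. -/
theorem exists_algHom_divisionRing.{u} {A : Type u} [Ring A] [Algebra ℝ A] [Nontrivial A]
    (hA : ∀ a : A, IsUnit a ∨ IsNilpotent a) :
    ∃ (D : Type u) (_ : DivisionRing D) (_ : Algebra ℝ D) (π : A →ₐ[ℝ] D),
      Function.Surjective π ∧ ∀ a, π a = 0 ↔ IsNilpotent a := by
  have : (nilIdeal hA).IsTwoSided :=
    ⟨fun b ha ↦ (hA _).resolve_left (not_isUnit_mul_of_isNilpotent ha b).1⟩
  have hmem : ∀ a, Ideal.Quotient.mk (nilIdeal hA) a = 0 ↔ IsNilpotent a := fun a ↦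
    Ideal.Quotient.eq_zero_iff_mem
  have : Nontrivial (A ⧸ nilIdeal hA) := by
    rw [Ideal.Quotient.nontrivial_iff, Ideal.ne_top_iff_one]
    exact not_isNilpotent_one
  have hD : ∀ x : A ⧸ nilIdeal hA, IsUnit x ∨ x = 0 := fun x ↦ by
    obtain ⟨a, rfl⟩ := Ideal.Quotient.mk_surjective x
    rcases hA a with ha | ha
    · exact Or.inl (ha.map _)
    · exact Or.inr ((hmem a).2 ha)
  exact ⟨A ⧸ nilIdeal hA, DivisionRing.ofIsUnitOrEqZero hD, Ideal.Quotient.algebra ℝ,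
    Ideal.Quotient.mkₐ ℝ (nilIdeal hA), Ideal.Quotient.mkₐ_surjective ℝ _, hmem⟩

end LocalAlgebra

/-! ### Endomorphisms of an indecomposable representation and of its powers -/

section Endomorphisms

variable {G X : Type*} [Monoid G] [AddCommGroup X] [Module ℝ X] (ρ : Representation ℝ G X)

/-- The ring of endomorphisms; the semiring and the additive group are those of Mathlib. -/
noncomputable instance : Ring (ρ.IntertwiningMap ρ) :=
  { Representation.IntertwiningMap.instSemiring ρ,
    (inferInstance : AddCommGroup (ρ.IntertwiningMap ρ)) with }

variable {ρ}

theorem toLinearMap_pow (L : EndRep ρ) (n : ℕ) : (L ^ n).toLinearMap = L.toLinearMap ^ n := by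
  induction n with
  | zero => rfl
  | succ n ih => rw [pow_succ, pow_succ, ← ih]; rfl

theorem IsIndecomposable.nontrivial_endRep (hρ : IsIndecomposable ρ) : Nontrivial (EndRep ρ) := by
  have := hρ.1
  obtain ⟨x, hx⟩ := exists_ne (0 : X)
  exact ⟨1, 0, fun h ↦ hx (congrArg (fun L : EndRep ρ ↦ L x) h)⟩

theorem isUnit_of_bijective {L : EndRep ρ} (hL : Function.Bijective L) : IsUnit L := by
  let e := L.ofBijective hL
  refine ⟨⟨L, e.symm.toIntertwiningMap, ?_, ?_⟩, rfl⟩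
  · ext x
    exact (LinearEquiv.ofBijective L.toLinearMap hL).apply_symm_apply x
  · ext x
    exact (LinearEquiv.ofBijective L.toLinearMap hL).symm_apply_apply x

/-- Fitting's lemma: `X` is the direct sum of the kernel and the range of a high power of `L`. -/
theorem IsIndecomposable.isUnit_or_isNilpotent [FiniteDimensional ℝ X] (hρ : IsIndecomposable ρ)
    (L : EndRep ρ) : IsUnit L ∨ IsNilpotent L := by
  obtain ⟨n, hn, hn1⟩ := ((LinearMap.eventually_isCompl_ker_pow_range_pow L.toLinearMap).and
    (Filter.eventually_ge_atTop 1)).exists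
  rw [← toLinearMap_pow] at hn
  have hc : IsCompl (L ^ n).ker (L ^ n).range := by
    refine IsCompl.of_eq ?_ ?_
    · exact Subrepresentation.toSubmodule_injective hn.inf_eq_bot
    · exact Subrepresentation.toSubmodule_injective hn.sup_eq_top
  rcases hρ.2 _ _ hc with h | h
  · right
    refine ⟨n, ?_⟩
    ext x
    have : x ∈ (L ^ n).ker := by rw [h]; exact Submodule.mem_top (R := ℝ)
    exact this
  · left
    have hs : Function.Surjective (L ^ n).toLinearMap := by
      intro x
      have : x ∈ (L ^ n).range := by rw [h]; exact Submodule.mem_top (R := ℝ)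
      exact this
    have hu : IsUnit (L ^ n) := isUnit_of_bijective ⟨LinearMap.injective_iff_surjective.2 hs, hs⟩
    exact (isUnit_pow_iff (by omega)).1 hu

theorem index_eq_finrank {D : Type*} [Ring D] [Algebra ℝ D] (π : EndRep ρ →ₐ[ℝ] D)
    (hπ : Function.Surjective π) (hnil : ∀ L, π L = 0 ↔ IsNilpotent L) :
    index ρ = finrank ℝ D := by
  have h : Submodule.span ℝ (nilEnd ρ) = LinearMap.ker π.toLinearMap := by
    have : nilEnd ρ = (LinearMap.ker π.toLinearMap : Set (EndRep ρ)) := by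
      ext L
      exact (hnil L).symm
    rw [this, Submodule.span_eq]
  exact ((Submodule.quotEquivOfEq _ _ h).trans
    (π.toLinearMap.quotKerEquivOfSurjective hπ)).finrank_eq

variable (ρ) (s : ℕ)

/-- The projection of `X ^ s` onto its `i`-th summand. -/
noncomputable def powerProj (i : Fin s) : (power ρ s).IntertwiningMap ρ where
  toLinearMap := DirectSum.component ℝ (Fin s) (fun _ ↦ X) i
  isIntertwining' _ := rfl

/-- The inclusion of the `i`-th summand into `X ^ s`. -/
noncomputable def powerIncl (i : Fin s) : ρ.IntertwiningMap (power ρ s) where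
  toLinearMap := DirectSum.lof ℝ (Fin s) (fun _ ↦ X) i
  isIntertwining' g := by ext; simp [Representation.directSum]

theorem powerProj_comp_powerIncl (i j : Fin s) :
    (powerProj ρ s i).comp (powerIncl ρ s j) = (1 : Matrix (Fin s) (Fin s) (EndRep ρ)) i j := by
  ext x
  rw [Matrix.one_apply]
  split_ifs with h
  · subst h
    exact DirectSum.component.lof_self (M := fun _ : Fin s ↦ X) ℝ i x
  · exact (DirectSum.component.of (M := fun _ : Fin s ↦ X) ℝ i j x).trans (dif_neg (Ne.symm h))

theorem sum_powerIncl_comp_powerProj :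
    ∑ i, (powerIncl ρ s i).comp (powerProj ρ s i) = (1 : EndRep (power ρ s)) := by
  apply Representation.IntertwiningMap.ext
  refine LinearMap.ext fun v ↦ ?_
  rw [Representation.IntertwiningMap.toLinearMap_sum, LinearMap.sum_apply]
  exact DirectSum.sum_univ_of v

/-- An endomorphism of `X ^ s` as an `s × s` matrix of endomorphisms of `X`. -/
noncomputable def endMatrix : EndRep (power ρ s) →ₐ[ℝ] Matrix (Fin s) (Fin s) (EndRep ρ) :=
  AlgHom.ofLinearMap
    { toFun := fun L ↦ Matrix.of fun i j ↦ (powerProj ρ s i).comp (L.comp (powerIncl ρ s j))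
      map_add' := fun L M ↦ by
        ext i j x
        exact map_add (powerProj ρ s i) _ _
      map_smul' := fun c L ↦ by
        ext i j x
        exact map_smul (powerProj ρ s i) c _ }
    (Matrix.ext (powerProj_comp_powerIncl ρ s))
    (fun L M ↦ by
      ext i j x
      have h := congrArg
        (fun N : EndRep (power ρ s) ↦ powerProj ρ s i (L (N (M (powerIncl ρ s j x)))))
        (sum_powerIncl_comp_powerProj ρ s)
      simp only [Representation.IntertwiningMap.sum_apply, map_sum] at h
      simp only [Matrix.mul_apply, Representation.IntertwiningMap.toLinearMap_sum,
        LinearMap.sum_apply]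
      exact h.symm)

theorem endMatrix_surjective : Function.Surjective (endMatrix ρ s) := by
  intro A
  refine ⟨∑ i, ∑ j, (powerIncl ρ s i).comp ((A i j).comp (powerProj ρ s j)), ?_⟩
  have key : ∀ i j, endMatrix ρ s ((powerIncl ρ s i).comp ((A i j).comp (powerProj ρ s j))) =
      Matrix.single i j (A i j) := fun i j ↦ by
    ext k l x
    change (powerProj ρ s k).comp (powerIncl ρ s i)
      (A i j ((powerProj ρ s j).comp (powerIncl ρ s l) x)) = Matrix.single i j (A i j) k l x
    rw [powerProj_comp_powerIncl, powerProj_comp_powerIncl, Matrix.one_apply, Matrix.one_apply,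
      Matrix.single_apply]
    rcases eq_or_ne k i with rfl | hk <;> rcases eq_or_ne j l with rfl | hl
    · simp
    · simp [hl]
    · simp [hk, hk.symm]
    · simp [hk, hk.symm]
  rw [map_sum]
  simp only [map_sum, key]
  exact (Matrix.matrix_eq_sum_single A).symm

end Endomorphisms

/-! ### Matrices over a division algebra -/

section Strata

variable {D : Type*} [DivisionRing D] {s : ℕ}

/-- The corank of a square matrix over a division ring: the dimension of the kernel of its action
on row vectors from the right, which is linear for the scalar multiplication from the left. -/
noncomputable def corank (A : Matrix (Fin s) (Fin s) D) : ℕ :=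
  finrank D (LinearMap.ker A.toLinearMapRight')

theorem isSubmanifold_corank [Algebra ℝ D] [FiniteDimensional ℝ D] (i : ℕ) :
    IsSubmanifold {A : Matrix (Fin s) (Fin s) D | corank A = i} (i ^ 2 * finrank ℝ D) := by
  let Λ : Matrix (Fin s) (Fin s) D →ₗ[ℝ] End D (Fin s → D) :=
    { toFun := fun A ↦ A.toLinearMapRight'
      map_add' := map_add _
      map_smul' := fun c A ↦ LinearMap.ext fun v ↦ by simp [Matrix.vecMul_smul] }
  exact (isSubmanifold_finrank_ker i).preimage Λ Matrix.toLinearMapRight'.surjective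

theorem toLinearMapRight'_pow (A : Matrix (Fin s) (Fin s) D) (n : ℕ) :
    (A ^ n).toLinearMapRight' = (A.toLinearMapRight' : End D (Fin s → D)) ^ n := by
  induction n with
  | zero => exact Matrix.toLinearMapRight'_one
  | succ n ih => rw [pow_succ', Matrix.toLinearMapRight'_mul, ih, pow_succ]; rfl

theorem corank_le (A : Matrix (Fin s) (Fin s) D) : corank A ≤ s :=
  (Submodule.finrank_le _).trans (by simp)

theorem one_le_corank (hs : 1 ≤ s) {A : Matrix (Fin s) (Fin s) D} (hA : IsNilpotent A) :
    1 ≤ corank A := by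
  rw [Nat.one_le_iff_ne_zero]
  intro h
  obtain ⟨n, hn⟩ := hA
  have hinj : Function.Injective (A.toLinearMapRight' : End D (Fin s → D)) :=
    LinearMap.ker_eq_bot.1 (Submodule.finrank_eq_zero.1 h)
  have hz : (A.toLinearMapRight' : End D (Fin s → D)) ^ n = 0 := by
    rw [← toLinearMapRight'_pow, hn, map_zero]
  have hinj' : Function.Injective ((A.toLinearMapRight' : End D (Fin s → D)) ^ n) := by
    rw [Module.End.coe_pow]; exact hinj.iterate n
  have := @hinj' (Pi.single ⟨0, hs⟩ 1) 0 (by rw [hz]; rfl)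
  simp at this

theorem linearIndependent_pow_of_corank_le_one {A : Matrix (Fin s) (Fin s) ℝ} (hA : IsNilpotent A)
    (hc : corank A ≤ 1) : LinearIndependent ℝ (fun k : Fin s ↦ A ^ (k : ℕ)) := by
  cases s with
  | zero => exact linearIndependent_empty_type
  | succ s =>
    refine linearIndependent_pow_of_isNilpotent hA fun h ↦ ?_
    have := finrank_ker_pow_le hc s
    rw [← toLinearMapRight'_pow, h, map_zero, LinearMap.ker_zero, finrank_top] at this
    simp at this

end Strata

/-! ### Covering the nilpotent elements -/

theorem mapMatrix_surjective {A B : Type*} [Ring A] [Algebra ℝ A] [Ring B] [Algebra ℝ B] {s : ℕ}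
    {π : A →ₐ[ℝ] B} (hπ : Function.Surjective π) :
    Function.Surjective (π.mapMatrix : Matrix (Fin s) (Fin s) A →ₐ[ℝ] Matrix (Fin s) (Fin s) B) :=
  fun M ↦ by
    choose g hg using hπ
    exact ⟨M.map g, Matrix.ext fun i j ↦ hg (M i j)⟩

/-- A nilpotent element has image of corank between `1` and `s`, so the preimages of the rank strata
cover the nilpotent elements. -/
theorem exists_cover_nilpotent {R D : Type*} [Ring R] [Algebra ℝ R] [FiniteDimensional ℝ R]
    [DivisionRing D] [Algebra ℝ D] {s : ℕ} (hs : 1 ≤ s) [FiniteDimensional ℝ D]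
    (Ψ : R →ₐ[ℝ] Matrix (Fin s) (Fin s) D) (hΨ : Function.Surjective Ψ) :
    ∃ S : ℕ → Set R,
      (∀ i ∈ Finset.Icc 1 s, IsSubmanifold (S i) (i ^ 2 * finrank ℝ D)) ∧
        {a : R | IsNilpotent a} ⊆ ⋃ i ∈ Finset.Icc 1 s, S i := by
  refine ⟨fun i ↦ Ψ ⁻¹' {A | corank A = i}, fun i _ ↦
    (isSubmanifold_corank i).preimage Ψ.toLinearMap hΨ, fun a ha ↦ ?_⟩
  simp only [Set.mem_iUnion]
  exact ⟨corank (Ψ a), Finset.mem_Icc.2 ⟨one_le_corank hs (IsNilpotent.map ha Ψ), corank_le _⟩, rfl⟩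

/-- Over `ℝ`, the stratum of corank one is replaced by the matrices `A` for which
`1, A, …, A ^ (s - 1)` are independent and the traces of `A, …, A ^ s` vanish; it contains
every nilpotent matrix of corank one. -/
theorem exists_cover_nilpotent_real {R : Type*} [Ring R] [Algebra ℝ R] [FiniteDimensional ℝ R]
    {s : ℕ} (hs : 1 ≤ s)
    (Ψ : R →ₐ[ℝ] Matrix (Fin s) (Fin s) ℝ) (hΨ : Function.Surjective Ψ) :
    ∃ S : ℕ → Set R, IsSubmanifold (S 1) s ∧
      (∀ i ∈ Finset.Icc 2 s, IsSubmanifold (S i) (i ^ 2)) ∧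
        {a : R | IsNilpotent a} ⊆ ⋃ i ∈ Finset.Icc 1 s, S i := by
  let T : Set (Matrix (Fin s) (Fin s) ℝ) := {A |
      LinearIndependent ℝ (fun k : Fin s ↦ A ^ (k : ℕ)) ∧
        ∀ k : Fin s, (A ^ ((k : ℕ) + 1)).trace = 0}
  refine ⟨fun i ↦ if i = 1 then Ψ ⁻¹' T else Ψ ⁻¹' {A | corank A = i}, ?_, fun i hi ↦ ?_,
    fun a ha ↦ ?_⟩
  · exact (isSubmanifold_linearIndependent_pow_trace s).preimage Ψ.toLinearMap hΨ
  · have hi1 : i ≠ 1 := by rw [Finset.mem_Icc] at hi; omega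
    simp only [if_neg hi1]
    simpa using (isSubmanifold_corank (D := ℝ) i).preimage Ψ.toLinearMap hΨ
  · have hn : IsNilpotent (Ψ a) := IsNilpotent.map ha Ψ
    simp only [Set.mem_iUnion]
    refine ⟨corank (Ψ a), Finset.mem_Icc.2 ⟨one_le_corank hs hn, corank_le _⟩, ?_⟩
    split_ifs with h
    · exact ⟨linearIndependent_pow_of_corank_le_one hn h.le, fun k ↦
        (Matrix.isNilpotent_trace_of_isNilpotent (hn.pow_succ k)).eq_zero⟩
    · rfl

end MonoidRep

theorem theorem2p4 {G X : Type*} [Monoid G] [AddCommGroup X] [Module ℝ X]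
    [FiniteDimensional ℝ X] (ρ : Representation ℝ G X) (hρ : MonoidRep.IsIndecomposable ρ)
    (s : ℕ) (hs : 1 ≤ s) :
    (MonoidRep.index ρ = 1 ∨ MonoidRep.index ρ = 2 ∨ MonoidRep.index ρ = 4) ∧
    (MonoidRep.index ρ = 1 →
      ∃ S : ℕ → Set (MonoidRep.EndRep (MonoidRep.power ρ s)),
        MonoidRep.IsSubmanifold (S 1) s ∧
        (∀ i ∈ Finset.Icc 2 s, MonoidRep.IsSubmanifold (S i) (i ^ 2)) ∧
        MonoidRep.nilEnd (MonoidRep.power ρ s) ⊆ ⋃ i ∈ Finset.Icc 1 s, S i) ∧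
    (MonoidRep.index ρ = 2 ∨ MonoidRep.index ρ = 4 →
      ∃ S : ℕ → Set (MonoidRep.EndRep (MonoidRep.power ρ s)),
        (∀ i ∈ Finset.Icc 1 s,
          MonoidRep.IsSubmanifold (S i) (i ^ 2 * MonoidRep.index ρ)) ∧
        MonoidRep.nilEnd (MonoidRep.power ρ s) ⊆ ⋃ i ∈ Finset.Icc 1 s, S i) := by
  have := hρ.nontrivial_endRep
  obtain ⟨D, _, _, π, hπ, hnil⟩ := MonoidRep.exists_algHom_divisionRing hρ.isUnit_or_isNilpotent
  have : FiniteDimensional ℝ D := Module.Finite.of_surjective π.toLinearMap hπ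
  have hind : MonoidRep.index ρ = Module.finrank ℝ D := MonoidRep.index_eq_finrank π hπ hnil
  let Ψ : MonoidRep.EndRep (MonoidRep.power ρ s) →ₐ[ℝ] Matrix (Fin s) (Fin s) D :=
    π.mapMatrix.comp (MonoidRep.endMatrix ρ s)
  have hΨ : Function.Surjective Ψ :=
    (MonoidRep.mapMatrix_surjective hπ).comp (MonoidRep.endMatrix_surjective ρ s)
  refine ⟨?_, fun h ↦ ?_, fun _ ↦ ?_⟩
  · rw [hind]
    exact MonoidRep.finrank_divisionRing_eq_one_or_two_or_four
  · rw [hind] at h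
    let e : ℝ ≃ₐ[ℝ] D := AlgEquiv.ofBijective (Algebra.ofId ℝ D)
      (Algebra.finrank_eq_one_iff_bijective_algebraMap.1 h)
    exact MonoidRep.exists_cover_nilpotent_real hs (e.symm.toAlgHom.mapMatrix.comp Ψ)
      ((MonoidRep.mapMatrix_surjective (π := e.symm.toAlgHom) e.symm.surjective).comp hΨ)
  · rw [hind]
    exact MonoidRep.exists_cover_nilpotent hs Ψ hΨ
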